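/- **Setting.** Let $G=(V,E)$ be a finite simple undirected graph. The random walk on $G$ moves at each step to a uniformly chosen neighbour of the current node. For nodes $x,y$ let $H(x,y)$ be the expected number of steps of the random walk started at $x$ before $y$ is visited (so $H(y,y)=0$). The RW-Closeness centrality of a node $v$ of a connected graph $G$ is $RWC_v(G)=\bigl(\sum_{x\in V\setminus\{v\}}H(x,v)\bigr)^{-1}$. Let $d$ be the graph distance and $Net(u,v)=|\{w\in V: d(w,u)<d(w,v)\}|$; write $u\succ v$ if $Net(u,v)>Net(v,u)$ and $u\succeq v$ if $Net(u,v)\ge Net(v,u)$. For $S\subseteq V$ let $E[S]$ be the set of edges of $G$ with both ends in $S$. A centrality measure $F$ satisfies *Condorcet Comparison* (on connected graphs) if for every connected graph $G$ and every edge $\{u,v\}$ of $G$: $u\succeq v \Leftrightarrow F_u(G)\ge F_v(G)$. It satisfies *Bridge* if for every graph $G$ and every edge $\{u,v\}$ whose removal leaves exactly two connected components $S_u\ni u$ and $S_v\ni v$: $|S_u|\ge|S_v| \Leftrightarrow F_u(G)\ge F_v(G)$. **Proposition.** For every graph $G$ and every edge $\{u,v\}$ of $G$ whose removal leaves exactly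 two connected components $S_u\ni u$ and $S_v\ni v$, all hitting times $H(x,y)$ are finite and $$RWC_v(G)^{-1}-RWC_u(G)^{-1}=|S_u|\,(2|E[S_u]|+1)-|S_v|\,(2|E[S_v]|+1).$$ RW-Closeness centrality satisfies neither Condorcet Comparison nor Bridge. Indeed, there are a graph $G$ and an edge $\{u,v\}$ of $G$ whose removal leaves exactly two connected components $S_u\ni u$ and $S_v\ni v$, such that $|S_u|<|S_v|$ and $v\succ u$, but $RWC_u(G)>RWC_v(G)$. -/

import Mathlib

open scoped ENNReal

noncomputable section

namespace GraphCentrality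

/-- One step of the simple random walk from `x`: a uniformly chosen neighbour of `x`.
(At an isolated vertex, where the walk has no possible move, it stays put.) -/
def stepPMF {V : Type*} [Fintype V] (G : SimpleGraph V) (x : V) : PMF V :=
  open Classical in
  if h : (G.neighborFinset x).Nonempty then PMF.uniformOfFinset (G.neighborFinset x) h
  else PMF.pure x

/-- The transition kernel of the simple random walk, on a discrete measurable space. -/
def stepKernel {V : Type*} [Fintype V] [MeasurableSpace V] [DiscreteMeasurableSpace V]
    (G : SimpleGraph V) : ProbabilityTheory.Kernel V V where
  toFun x := (stepPMF G x).toMeasure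
  measurable' := Measurable.of_discrete

instance {V : Type*} [Fintype V] [MeasurableSpace V] [DiscreteMeasurableSpace V]
    (G : SimpleGraph V) : ProbabilityTheory.IsMarkovKernel (stepKernel G) :=
  ⟨fun x => PMF.toMeasure.isProbabilityMeasure (stepPMF G x)⟩

/-- The kernel giving `v_{t+1}` from the history `(v_0, …, v_t)`: it depends on `v_t` only. -/
def historyKernel {V : Type*} [Fintype V] [MeasurableSpace V] [DiscreteMeasurableSpace V]
    (G : SimpleGraph V) (t : ℕ) : ProbabilityTheory.Kernel (Finset.Iic t → V) V :=
  (stepKernel G).comap (fun h => h ⟨t, Finset.mem_Iic.2 le_rfl⟩) (measurable_pi_apply _)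

instance {V : Type*} [Fintype V] [MeasurableSpace V] [DiscreteMeasurableSpace V]
    (G : SimpleGraph V) (t : ℕ) : ProbabilityTheory.IsMarkovKernel (historyKernel G t) :=
  inferInstanceAs (ProbabilityTheory.IsMarkovKernel ((stepKernel G).comap _ _))

/-- The law, on infinite sequences of nodes, of the random walk on `G` started at `u`. -/
def walkLaw {V : Type*} [Fintype V] [MeasurableSpace V] [DiscreteMeasurableSpace V]
    (G : SimpleGraph V) (u : V) : MeasureTheory.Measure (ℕ → V) :=
  ProbabilityTheory.Kernel.trajMeasure (X := fun _ => V)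
    (MeasureTheory.Measure.dirac u) (historyKernel G)

/-- The first time at which the sequence `ω` visits `v` (`∞` if it never does). -/
def firstVisit {V : Type*} (v : V) (ω : ℕ → V) : ℝ≥0∞ :=
  ⨅ (t : ℕ) (_ : ω t = v), (t : ℝ≥0∞)

/-- The hitting time `H(u,v)`: expected number of steps of the random walk started at `u`
before `v` is visited. -/
def hittingTime {V : Type*} [Fintype V] (G : SimpleGraph V) (u v : V) : ℝ≥0∞ :=
  letI : MeasurableSpace V := ⊤
  ∫⁻ ω, firstVisit v ω ∂(walkLaw G u)

/-- Random-Walk Closeness centrality (meant for connected graphs). -/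
def rwc {V : Type*} [Fintype V] (G : SimpleGraph V) (v : V) : ℝ :=
  open Classical in
  ((∑ u ∈ Finset.univ.erase v, hittingTime G u v)⁻¹).toReal

/-- `Net(u,v)`: the number of nodes strictly closer to `u` than to `v`. -/
def net {V : Type*} (G : SimpleGraph V) (u v : V) : ℕ :=
  {w : V | G.edist w u < G.edist w v}.ncard

/-- `u ≻ v`. -/
def Beats {V : Type*} (G : SimpleGraph V) (u v : V) : Prop :=
  net G v u < net G u v

/-- `u ⪰ v`, i.e. `u ≻ v` or `u ∼ v`. -/
def WeaklyBeats {V : Type*} (G : SimpleGraph V) (u v : V) : Prop :=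
  Beats G u v ∨ net G u v = net G v u

/-- `K(G)`: the set of connected components of `G`, as sets of nodes. -/
def components {V : Type*} (G : SimpleGraph V) : Set (Set V) :=
  Set.range fun c : G.ConnectedComponent => c.supp

/-- `{u,v}` is an edge of `G` whose removal leaves exactly the two distinct connected components
`Su ∋ u` and `Sv ∋ v`. (Then `G` is connected and `{u,v}` is a bridge.) -/
structure IsBridgeSplit {V : Type*} (G : SimpleGraph V) (u v : V) (Su Sv : Set V) : Prop where
  adj : G.Adj u v
  left_mem : u ∈ Su
  right_mem : v ∈ Sv
  ne : Su ≠ Sv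
  components_eq : components (G.deleteEdges {s(u, v)}) = {Su, Sv}

/-- A centrality measure: a real value for every node of every finite graph. -/
abbrev Centrality : Type 1 :=
  ∀ (V : Type) [Fintype V], SimpleGraph V → V → ℝ

/-- Condorcet Comparison, on connected graphs. -/
def CondorcetComparison (F : Centrality) : Prop :=
  ∀ (V : Type) [Fintype V] (G : SimpleGraph V), G.Connected →
    ∀ u v : V, G.Adj u v → (WeaklyBeats G u v ↔ F V G v ≤ F V G u)

/-- The Bridge axiom. -/
def BridgeAxiom (F : Centrality) : Prop :=
  ∀ (V : Type) [Fintype V] (G : SimpleGraph V) (u v : V) (Su Sv : Set V),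
    IsBridgeSplit G u v Su Sv → (Sv.ncard ≤ Su.ncard ↔ F V G v ≤ F V G u)

/-- RW-Closeness as a centrality measure. -/
def rwCloseness : Centrality := fun _ _ G v => rwc G v

end GraphCentrality

end

/-! Write $h(x)=H(x,v)$. Off $v$ the one-step equation, multiplied by the degree, reads $\deg
x=\sum_{y\sim x}(h(x)-h(y))$. Summed over $S_u$, the antisymmetric flow cancels on inner edges and
leaves only the bridge, so $H(u,v)=\sum_{x\in S_u}\deg x=2|E[S_u]|+1$ (`hittingTime_across`,
`sum_degree`). A walk from $x\in S_u$ to $v$ must pass through $u$, hence $H(x,v)=H(x,u)+H(u,v)$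
(`hittingTime_add`). With the mirror identity on $S_v$, summing over all nodes gives the formula.
Finiteness comes from comparing $H(\cdot,v)$, the least supersolution of the one-step equation, with
a real solution of a Dirichlet problem. Since $Net(u,v)=|S_u|$ across a bridge, both axioms compare
sizes only, while RW-Closeness also counts edges: a small dense side can beat a larger sparse one.
$K_4$ bridged to a 5-node star does this. -/

noncomputable section

namespace GraphCentrality

open MeasureTheory ProbabilityTheory Preorder

/-! ### Hitting times as a series in the walk killed at the target -/

section Walk

variable {V : Type*}

open scoped Classical in
-- Tail-sum formula: a first visit time counts the times up to which `v` has been avoided.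
theorem firstVisit_eq_tsum (v : V) (ω : ℕ → V) :
    firstVisit v ω = ∑' t : ℕ, if ∀ s ≤ t, ω s ≠ v then (1 : ℝ≥0∞) else 0 := by
  unfold firstVisit
  by_cases h : ∃ t, ω t = v
  · have hn := Nat.find_spec h
    have hmin : ∀ s, s < Nat.find h → ω s ≠ v := fun s hs => Nat.find_min h hs
    set n := Nat.find h
    rw [tsum_eq_sum (s := Finset.range n)]
    · rw [Finset.sum_congr rfl (g := fun _ => (1 : ℝ≥0∞))]
      · simp only [Finset.sum_const, Finset.card_range, nsmul_eq_mul, mul_one]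
        refine le_antisymm (iInf₂_le n hn) (le_iInf₂ fun t ht => ?_)
        have : n ≤ t := by
          by_contra hlt
          exact hmin t (not_le.1 hlt) ht
        exact_mod_cast this
      · intro t ht
        rw [if_pos]
        intro s hs
        exact hmin s (lt_of_le_of_lt hs (Finset.mem_range.1 ht))
    · intro t ht
      rw [if_neg]
      intro hall
      exact hall n (by simpa using ht) hn
  · push Not at h
    simp [h]

theorem measurableSet_forall_mem_ne [MeasurableSpace V] [DiscreteMeasurableSpace V]
    {ι : Type*} [Countable ι] (S : Set ι) (v : V) :
    MeasurableSet {ω : ι → V | ∀ i ∈ S, ω i ≠ v} := by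
  have : {ω : ι → V | ∀ i ∈ S, ω i ≠ v} = ⋂ i ∈ S, (fun ω : ι → V => ω i) ⁻¹' {v}ᶜ := by
    ext ω; simp
  rw [this]
  exact MeasurableSet.iInter fun i => MeasurableSet.iInter fun _ =>
    measurable_pi_apply i MeasurableSet.of_discrete

variable [Fintype V] [MeasurableSpace V] [DiscreteMeasurableSpace V]

theorem lintegral_walkLaw_zero (G : SimpleGraph V) (u : V) (f : V → ℝ≥0∞) :
    ∫⁻ ω, f (ω 0) ∂walkLaw G u = f u := by
  have hmap : (walkLaw G u).map (frestrictLe (π := fun _ => V) 0) =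
      (Measure.dirac u).map (MeasurableEquiv.piUnique (fun _ : Finset.Iic 0 => V)).symm := by
    unfold walkLaw Kernel.trajMeasure
    rw [Measure.map_comp _ _ (by fun_prop), Kernel.traj_map_frestrictLe,
      Kernel.partialTraj_self, Measure.id_comp]
  have hf : Measurable fun h : Finset.Iic 0 → V => f (h ⟨0, Finset.mem_Iic.2 le_rfl⟩) :=
    (Measurable.of_discrete (f := f)).comp (measurable_pi_apply _)
  have h1 := lintegral_map (μ := walkLaw G u) hf
    (measurable_frestrictLe (X := fun _ => V) 0)
  rw [hmap, lintegral_map hf (MeasurableEquiv.measurable _), lintegral_dirac] at h1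
  exact h1.symm

/-- The Markov property: the history `g` up to time `t` and the next position. -/
theorem lintegral_walkLaw_succ (G : SimpleGraph V) (u : V) (t : ℕ)
    (g : (Finset.Iic t → V) → ℝ≥0∞) (hg : Measurable g) (f : V → ℝ≥0∞) :
    ∫⁻ ω, g (frestrictLe t ω) * f (ω (t + 1)) ∂walkLaw G u =
      ∫⁻ ω, g (frestrictLe t ω) * ∫⁻ y, f y ∂stepKernel G (ω t) ∂walkLaw G u := by
  have key := Kernel.map_frestrictLe_trajMeasure_compProd_eq_map_trajMeasure
    (X := fun _ => V) (μ₀ := Measure.dirac u) (κ := historyKernel G) (a := t)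
  have hf : Measurable f := Measurable.of_discrete
  have hF : Measurable fun p : (Finset.Iic t → V) × V => g p.1 * f p.2 :=
    (hg.comp measurable_fst).mul (hf.comp measurable_snd)
  have h1 := lintegral_map (μ := walkLaw G u) hF
    (g := fun ω : ℕ → V => (frestrictLe (π := fun _ => V) t ω, ω (t + 1))) (by fun_prop)
  have h2 : ∫⁻ p, g p.1 * f p.2 ∂(((walkLaw G u).map (frestrictLe (π := fun _ => V) t)) ⊗ₘ
      historyKernel G t) = ∫⁻ ω, g (frestrictLe t ω) * f (ω (t + 1)) ∂walkLaw G u := by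
    rw [← h1]
    exact congrArg (fun m => lintegral m _) key
  rw [← h2, Measure.lintegral_compProd hF, lintegral_map]
  · refine lintegral_congr fun ω => ?_
    have hk : historyKernel G t (frestrictLe t ω) = stepKernel G (ω t) :=
      Kernel.comap_apply _ _ _
    rw [hk]
    exact lintegral_const_mul (μ := stepKernel G (ω t)) (g (frestrictLe t ω)) hf
  · exact hF.lintegral_kernel_prod_right'
  · fun_prop

open scoped Classical in
/-- One step of the walk killed at `v`, acting on functions. -/
def killedStep (G : SimpleGraph V) (v : V) (f : V → ℝ≥0∞) (x : V) : ℝ≥0∞ :=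
  if x = v then 0 else ∫⁻ y, f y ∂stepKernel G x

theorem killedStep_self (G : SimpleGraph V) (v : V) (f : V → ℝ≥0∞) : killedStep G v f v = 0 := by
  simp [killedStep]

open scoped Classical in
-- The Markov property integrates out the last step, which turns `f` into `killedStep G v f`. Since
-- `f` vanishes at `v`, avoidance at the last time is automatic, so only the history up to the
-- previous time is constrained.
theorem lintegral_avoid_mul (G : SimpleGraph V) (u v : V) (t : ℕ) (f : V → ℝ≥0∞) (hf : f v = 0) :
    ∫⁻ ω, (if ∀ s ≤ t, ω s ≠ v then (1 : ℝ≥0∞) else 0) * f (ω t) ∂walkLaw G u =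
      (killedStep G v)^[t] f u := by
  induction t generalizing f with
  | zero =>
    rw [Function.iterate_zero, id, ← lintegral_walkLaw_zero G u f]
    refine lintegral_congr fun ω => ?_
    by_cases h : ω 0 = v <;> simp [h, hf]
  | succ t ih =>
    rw [Function.iterate_succ_apply, ← ih _ (killedStep_self G v f)]
    let g : (Finset.Iic t → V) → ℝ≥0∞ := fun h => if ∀ s, h s ≠ v then 1 else 0
    have hg : Measurable g := by
      refine Measurable.ite ?_ measurable_const measurable_const
      simpa using measurableSet_forall_mem_ne (V := V) (Set.univ : Set (Finset.Iic t)) v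
    have hgω : ∀ ω : ℕ → V, g (frestrictLe t ω) = if ∀ s ≤ t, ω s ≠ v then 1 else 0 := by
      intro ω
      exact if_congr ⟨fun H s hs => H ⟨s, Finset.mem_Iic.2 hs⟩,
        fun H s => H s (Finset.mem_Iic.1 s.2)⟩ rfl rfl
    have := lintegral_walkLaw_succ G u t g hg f
    simp only [hgω] at this
    calc _ = ∫⁻ ω, (if ∀ s ≤ t, ω s ≠ v then (1 : ℝ≥0∞) else 0) * f (ω (t + 1)) ∂walkLaw G u := by
          refine lintegral_congr fun ω => ?_
          by_cases h : ω (t + 1) = v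
          · simp [h, hf]
          · congr 1
            refine if_congr ⟨fun H s hs => H s (by omega), fun H s hs => ?_⟩ rfl rfl
            rcases Nat.le_succ_iff.1 hs with h' | rfl
            · exact H s h'
            · exact h
      _ = _ := by
          rw [this]
          refine lintegral_congr fun ω => ?_
          by_cases h : ∀ s ≤ t, ω s ≠ v
          · simp only [killedStep, if_neg (h t le_rfl)]
          · simp [h]

open scoped Classical in
theorem lintegral_firstVisit (G : SimpleGraph V) (u v : V) :
    ∫⁻ ω, firstVisit v ω ∂walkLaw G u =
      ∑' t : ℕ, (killedStep G v)^[t] (fun x => if x = v then 0 else 1) u := by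
  simp only [firstVisit_eq_tsum]
  rw [lintegral_tsum]
  · refine tsum_congr fun t => ?_
    rw [← lintegral_avoid_mul G u v t _ (if_pos rfl)]
    refine lintegral_congr fun ω => ?_
    by_cases h : ∀ s ≤ t, ω s ≠ v
    · simp [h t le_rfl]
    · simp [h]
  · intro t
    refine (Measurable.ite ?_ measurable_const measurable_const).aemeasurable
    exact measurableSet_forall_mem_ne (Set.Iic t) v

theorem killedStep_tsum (G : SimpleGraph V) (v : V) (f : ℕ → V → ℝ≥0∞) (x : V) :
    killedStep G v (fun y => ∑' t, f t y) x = ∑' t, killedStep G v (f t) x := by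
  unfold killedStep
  split_ifs
  · simp
  · exact lintegral_tsum fun t => Measurable.of_discrete.aemeasurable

theorem killedStep_mono (G : SimpleGraph V) (v : V) {f g : V → ℝ≥0∞} (h : f ≤ g) :
    killedStep G v f ≤ killedStep G v g := by
  intro x
  unfold killedStep
  split_ifs
  · exact le_rfl
  · exact lintegral_mono h

open scoped Classical in
theorem lintegral_firstVisit_eq (G : SimpleGraph V) (u v : V) :
    ∫⁻ ω, firstVisit v ω ∂walkLaw G u = (if u = v then 0 else 1) +
      killedStep G v (fun x => ∫⁻ ω, firstVisit v ω ∂walkLaw G x) u := by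
  simp only [lintegral_firstVisit]
  rw [killedStep_tsum, tsum_eq_zero_add' ENNReal.summable]
  simp only [Function.iterate_succ_apply', Function.iterate_zero, id]

open scoped Classical in
-- Minimality among supersolutions: each partial sum of the series stays below `s`. This is how
-- finiteness will be obtained.
theorem lintegral_firstVisit_le (G : SimpleGraph V) (v : V) (s : V → ℝ≥0∞)
    (hs : ∀ x, (if x = v then 0 else 1) + killedStep G v s x ≤ s x) (u : V) :
    ∫⁻ ω, firstVisit v ω ∂walkLaw G u ≤ s u := by
  rw [lintegral_firstVisit]
  refine ENNReal.tsum_le_of_sum_range_le fun n => ?_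
  induction n generalizing u with
  | zero => simp
  | succ n ih =>
    -- Splitting off the term at time 0 leaves `killedStep` of the previous partial sum.
    rw [Finset.sum_range_succ']
    refine le_trans ?_ (hs u)
    rw [add_comm]
    refine add_le_add (by simp) ?_
    refine le_trans (le_of_eq ?_) (killedStep_mono G v ih u)
    simp only [Function.iterate_succ_apply']
    unfold killedStep
    split_ifs
    · simp
    · exact (lintegral_finsetSum _ fun t _ => Measurable.of_discrete).symm

open scoped Classical in
theorem lintegral_stepKernel (G : SimpleGraph V) (x : V) (h : (G.neighborFinset x).Nonempty)
    (f : V → ℝ≥0∞) :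
    ∫⁻ y, f y ∂stepKernel G x = (∑ y ∈ G.neighborFinset x, f y) / G.degree x := by
  have hk : stepKernel G x = (PMF.uniformOfFinset (G.neighborFinset x) h).toMeasure := by
    change (stepPMF G x).toMeasure = _
    rw [stepPMF, dif_pos h]
  rw [hk, lintegral_fintype, ENNReal.div_eq_inv_mul, Finset.mul_sum,
    ← Finset.sum_filter_add_sum_filter_not Finset.univ (· ∈ G.neighborFinset x),
    Finset.filter_univ_mem, Finset.sum_eq_zero (s := Finset.filter _ _), add_zero]
  · refine Finset.sum_congr rfl fun y hy => ?_
    rw [PMF.toMeasure_apply_singleton _ _ (MeasurableSet.of_discrete),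
      PMF.uniformOfFinset_apply_of_mem h hy, mul_comm, SimpleGraph.card_neighborFinset_eq_degree]
  · intro y hy
    rw [PMF.toMeasure_apply_singleton _ _ (MeasurableSet.of_discrete),
      PMF.uniformOfFinset_apply_of_notMem h (Finset.mem_filter.1 hy).2, mul_zero]

end Walk

/-! ### One-step equation and comparison for hitting times -/

section HittingTime

variable {V : Type*} [Fintype V]

theorem hittingTime_self (G : SimpleGraph V) (v : V) : hittingTime G v v = 0 := by
  let _ : MeasurableSpace V := ⊤
  unfold hittingTime
  rw [lintegral_firstVisit_eq]
  simp [killedStep_self]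

open scoped Classical in
theorem hittingTime_of_ne (G : SimpleGraph V) {x v : V} (hx : x ≠ v)
    (hd : (G.neighborFinset x).Nonempty) :
    hittingTime G x v = 1 + (∑ y ∈ G.neighborFinset x, hittingTime G y v) / G.degree x := by
  let _ : MeasurableSpace V := ⊤
  unfold hittingTime
  conv_lhs => rw [lintegral_firstVisit_eq, if_neg hx, killedStep, if_neg hx,
    lintegral_stepKernel G x hd]

open scoped Classical in
theorem hittingTime_le (G : SimpleGraph V) (v : V) (s : V → ℝ≥0∞)
    (hd : ∀ x, x ≠ v → (G.neighborFinset x).Nonempty)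
    (hs : ∀ x, x ≠ v → 1 + (∑ y ∈ G.neighborFinset x, s y) / G.degree x ≤ s x) (u : V) :
    hittingTime G u v ≤ s u := by
  let _ : MeasurableSpace V := ⊤
  unfold hittingTime
  refine lintegral_firstVisit_le G v s (fun x => ?_) u
  by_cases hx : x = v
  · subst hx
    simp [killedStep_self]
  · rw [if_neg hx, killedStep, if_neg hx, lintegral_stepKernel G x (hd x hx)]
    exact hs x hx

end HittingTime

/-! ### Discrete potential theory and finiteness -/

section Potential

variable {V : Type*} [Fintype V]

open scoped Classical in
/-- Minimum principle: a function superharmonic off `v` and nonnegative at `v` is nonnegative. -/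
theorem nonneg_of_superharmonic {G : SimpleGraph V} (hG : G.Preconnected) {v : V} {f : V → ℝ}
    (hv : 0 ≤ f v) (hf : ∀ x, x ≠ v → ∑ y ∈ G.neighborFinset x, f y ≤ G.degree x * f x) (x : V) :
    0 ≤ f x := by
  obtain ⟨x₀, -, hx₀⟩ := Finset.exists_min_image Finset.univ f ⟨v, Finset.mem_univ v⟩
  by_contra hneg
  have hm : f x₀ < 0 := (hx₀ x (Finset.mem_univ x)).trans_lt (not_le.1 hneg)
  -- At a negative minimum, superharmonicity forces every neighbour to attain the minimum too;
  -- connectedness carries this value to `v`.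
  have step : ∀ y z, G.Adj y z → f y = f x₀ → f z = f x₀ := by
    intro y z hyz hy
    have hyv : y ≠ v := by rintro rfl; linarith
    have h0 : ∑ w ∈ G.neighborFinset y, (f w - f x₀) ≤ 0 := by
      rw [Finset.sum_sub_distrib, Finset.sum_const, SimpleGraph.card_neighborFinset_eq_degree,
        nsmul_eq_mul]
      have := hf y hyv
      rw [hy] at this
      linarith
    have hnn : ∀ w ∈ G.neighborFinset y, 0 ≤ f w - f x₀ := fun w _ =>
      sub_nonneg.2 (hx₀ w (Finset.mem_univ w))
    have := (Finset.sum_eq_zero_iff_of_nonneg hnn).1 (le_antisymm h0 (Finset.sum_nonneg hnn)) z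
      (by simpa using hyz)
    linarith
  obtain ⟨p⟩ := hG x₀ v
  have walk : ∀ {a b : V} (_ : G.Walk a b), f a = f x₀ → f b = f x₀ := by
    intro a b p
    induction p with
    | nil => exact id
    | cons h _ ih => exact fun ha => ih (step _ _ h ha)
  have := walk p rfl
  linarith

open scoped Classical in
theorem eq_zero_of_harmonic {G : SimpleGraph V} (hG : G.Preconnected) {v : V} {f : V → ℝ}
    (hv : f v = 0) (hf : ∀ x, x ≠ v → ∑ y ∈ G.neighborFinset x, f y = G.degree x * f x) (x : V) :
    f x = 0 := by
  refine le_antisymm ?_ (nonneg_of_superharmonic hG hv.ge (fun x hx => (hf x hx).le) x)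
  have := nonneg_of_superharmonic hG (f := fun x => - f x) (v := v) (by simp [hv])
    (fun x hx => by rw [Finset.sum_neg_distrib, hf x hx]; linarith) x
  linarith

open scoped Classical in
/-- Solvability of the Dirichlet problem on a connected graph. -/
theorem exists_dirichlet_solution {G : SimpleGraph V} (hG : G.Preconnected) (v : V) (b : V → ℝ) :
    ∃ s : V → ℝ, s v = b v ∧
      ∀ x, x ≠ v → G.degree x * s x = b x + ∑ y ∈ G.neighborFinset x, s y := by
  let L : (V → ℝ) →ₗ[ℝ] (V → ℝ) :=
    { toFun := fun f x => if x = v then f v else G.degree x * f x - ∑ y ∈ G.neighborFinset x, f y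
      map_add' := fun f g => by
        ext x
        by_cases h : x = v <;> simp [h, Finset.sum_add_distrib]
        ring
      map_smul' := fun c f => by
        ext x
        by_cases h : x = v <;> simp [h, ← Finset.mul_sum]
        ring }
  have hL : ∀ f x, L f x =
      if x = v then f v else G.degree x * f x - ∑ y ∈ G.neighborFinset x, f y := fun _ _ => rfl
  -- In finite dimension, uniqueness of the Dirichlet solution gives existence.
  have hinj : Function.Injective L := by
    rw [← LinearMap.ker_eq_bot, LinearMap.ker_eq_bot']
    intro f hf
    ext x
    refine eq_zero_of_harmonic hG (v := v) ?_ (fun x hx => ?_) x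
    · simpa [hL] using congrFun hf v
    · have := congrFun hf x
      rw [hL, if_neg hx, Pi.zero_apply] at this
      linarith
  obtain ⟨s, hs⟩ := LinearMap.surjective_of_injective hinj b
  refine ⟨s, ?_, fun x hx => ?_⟩
  · simpa [hL] using congrFun hs v
  · have := congrFun hs x
    rw [hL, if_neg hx] at this
    linarith

open scoped Classical in
theorem neighborFinset_nonempty {G : SimpleGraph V} (hG : G.Preconnected) {x v : V} (h : x ≠ v) :
    (G.neighborFinset x).Nonempty := by
  obtain ⟨p⟩ := hG x v
  cases p with
  | nil => exact absurd rfl h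
  | cons h' _ => exact ⟨_, (G.mem_neighborFinset _ _).2 h'⟩

/-- The Dirichlet solution with source `G.degree` and value 0 at `v` is nonnegative by the minimum
principle, so its `ENNReal.ofReal` is a finite supersolution. -/
theorem hittingTime_ne_top {G : SimpleGraph V} (hG : G.Preconnected) (x v : V) :
    hittingTime G x v ≠ ⊤ := by
  classical
  obtain ⟨s, hsv, hs⟩ := exists_dirichlet_solution hG v
    (fun x => if x = v then 0 else (G.degree x : ℝ))
  rw [if_pos rfl] at hsv
  have hpos : ∀ x, 0 ≤ s x := nonneg_of_superharmonic hG hsv.ge fun x hx => by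
    rw [hs x hx, if_neg hx]
    simp
  refine ne_top_of_le_ne_top (ENNReal.ofReal_ne_top (r := s x))
    (hittingTime_le G v (fun x => ENNReal.ofReal (s x))
      (fun x hx => neighborFinset_nonempty hG hx) (fun x hx => ?_) x)
  have hd : 0 < (G.degree x : ℝ) := by
    rw [← SimpleGraph.card_neighborFinset_eq_degree]
    exact_mod_cast (neighborFinset_nonempty hG hx).card_pos
  rw [← ENNReal.ofReal_sum_of_nonneg fun y _ => hpos y, ← ENNReal.ofReal_natCast,
    ← ENNReal.ofReal_div_of_pos hd, ← ENNReal.ofReal_one, ← ENNReal.ofReal_add zero_le_one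
      (div_nonneg (Finset.sum_nonneg fun y _ => hpos y) hd.le)]
  refine ENNReal.ofReal_le_ofReal ?_
  have := hs x hx
  rw [if_neg hx] at this
  rw [← mul_le_mul_iff_right₀ hd, this]
  field_simp
  rfl

open scoped Classical in
theorem degree_mul_hittingTime {G : SimpleGraph V} (hG : G.Preconnected) {x v : V} (hx : x ≠ v) :
    G.degree x * (hittingTime G x v).toReal =
      G.degree x + ∑ y ∈ G.neighborFinset x, (hittingTime G y v).toReal := by
  have hne := neighborFinset_nonempty hG hx
  have hd : (G.degree x : ℝ) ≠ 0 := by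
    rw [← SimpleGraph.card_neighborFinset_eq_degree]
    exact_mod_cast hne.card_pos.ne'
  have hd' : (G.degree x : ℝ≥0∞) ≠ 0 := by exact_mod_cast hd
  have hs : ∑ y ∈ G.neighborFinset x, hittingTime G y v ≠ ⊤ :=
    ENNReal.sum_ne_top.2 fun y _ => hittingTime_ne_top hG y v
  rw [hittingTime_of_ne G hx hne, ENNReal.toReal_add ENNReal.one_ne_top
    (ENNReal.div_ne_top hs hd'), ENNReal.toReal_div, ENNReal.toReal_sum
      fun y _ => hittingTime_ne_top hG y v, ENNReal.toReal_natCast, ENNReal.toReal_one]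
  field_simp

open scoped Classical in
theorem inv_rwc {G : SimpleGraph V} (hG : G.Preconnected) (v : V) :
    (rwc G v)⁻¹ = ∑ x, (hittingTime G x v).toReal := by
  rw [rwc, ENNReal.toReal_inv, inv_inv, ENNReal.toReal_sum fun y _ => hittingTime_ne_top hG y v]
  rw [← Finset.add_sum_erase Finset.univ _ (Finset.mem_univ v), hittingTime_self]
  simp

end Potential

/-! ### Structure of a bridge split -/

section Bridge

variable {V : Type*} {G : SimpleGraph V} {u v : V} {Su Sv : Set V}

theorem eq_setOf_reachable_of_mem_components {H : SimpleGraph V} {S : Set V}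
    (hS : S ∈ components H) (hu : u ∈ S) : S = {x | H.Reachable x u} := by
  obtain ⟨c, rfl⟩ := hS
  ext x
  rw [SimpleGraph.ConnectedComponent.mem_supp_iff] at hu
  subst hu
  exact SimpleGraph.ConnectedComponent.eq

namespace IsBridgeSplit

theorem symm (h : IsBridgeSplit G u v Su Sv) : IsBridgeSplit G v u Sv Su :=
  ⟨h.adj.symm, h.right_mem, h.left_mem, h.ne.symm, by
    rw [Sym2.eq_swap, h.components_eq, Set.pair_comm]⟩

theorem left_eq (h : IsBridgeSplit G u v Su Sv) :
    Su = {x | (G.deleteEdges {s(u, v)}).Reachable x u} :=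
  eq_setOf_reachable_of_mem_components (by simp [h.components_eq]) h.left_mem

theorem right_eq (h : IsBridgeSplit G u v Su Sv) :
    Sv = {x | (G.deleteEdges {s(u, v)}).Reachable x v} :=
  eq_setOf_reachable_of_mem_components (by simp [h.components_eq]) h.right_mem

theorem right_eq_compl (h : IsBridgeSplit G u v Su Sv) : Sv = Suᶜ := by
  ext x
  constructor
  · intro hv hu
    apply h.ne
    have hxu : x ∈ {x | (G.deleteEdges {s(u, v)}).Reachable x u} := h.left_eq ▸ hu
    have hxv : x ∈ {x | (G.deleteEdges {s(u, v)}).Reachable x v} := h.right_eq ▸ hv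
    have huv : (G.deleteEdges {s(u, v)}).Reachable u v := hxu.symm.trans hxv
    rw [h.left_eq, h.right_eq]
    ext y
    exact ⟨fun hy => SimpleGraph.Reachable.trans hy huv,
      fun hy => SimpleGraph.Reachable.trans hy huv.symm⟩
  · intro hu
    have : ((G.deleteEdges {s(u, v)}).connectedComponentMk x).supp ∈ ({Su, Sv} : Set (Set V)) :=
      h.components_eq ▸ ⟨_, rfl⟩
    have hx : x ∈ ((G.deleteEdges {s(u, v)}).connectedComponentMk x).supp := rfl
    rcases this with h1 | h1
    · exact absurd (h1 ▸ hx) hu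
    · exact (Set.mem_singleton_iff.1 h1) ▸ hx

theorem notMem_left (h : IsBridgeSplit G u v Su Sv) : v ∉ Su := by
  have := h.right_mem
  rwa [h.right_eq_compl] at this

theorem preconnected (h : IsBridgeSplit G u v Su Sv) : G.Preconnected := by
  have key : ∀ x, G.Reachable x u := by
    intro x
    by_cases hx : x ∈ Su
    · rw [h.left_eq] at hx
      exact SimpleGraph.Reachable.mono (SimpleGraph.deleteEdges_le _) hx
    · rw [← Set.mem_compl_iff, ← h.right_eq_compl, h.right_eq] at hx
      exact (SimpleGraph.Reachable.mono (SimpleGraph.deleteEdges_le _) hx).trans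
        h.adj.symm.reachable
  exact fun x y => (key x).trans (key y).symm

/-- The only edge leaving `Su` is `{u, v}`. -/
theorem eq_of_adj (h : IsBridgeSplit G u v Su Sv) {x y : V} (hx : x ∈ Su) (hy : y ∉ Su)
    (hxy : G.Adj x y) : x = u ∧ y = v := by
  have huv := h.notMem_left
  by_cases he : s(x, y) = s(u, v)
  · rcases Sym2.eq_iff.1 he with h' | h'
    · exact h'
    · exact absurd (h'.1 ▸ hx) huv
  · refine absurd ?_ hy
    rw [h.left_eq] at hx ⊢
    have : (G.deleteEdges {s(u, v)}).Adj y x :=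
      SimpleGraph.deleteEdges_adj.2 ⟨hxy.symm, by
        rw [Set.mem_singleton_iff, Sym2.eq_swap (a := y)]
        exact he⟩
    exact this.reachable.trans hx

end IsBridgeSplit

end Bridge

/-! ### The closeness difference across a bridge -/

section BridgeFormula

variable {V : Type*} [Fintype V] {G : SimpleGraph V} {u v : V} {Su Sv : Set V}

open scoped Classical in
/-- Summing an antisymmetric edge flow over `Su`, only the flow through the bridge survives. -/
theorem IsBridgeSplit.sum_sum_sub (h : IsBridgeSplit G u v Su Sv) (f : V → ℝ) :
    ∑ x with x ∈ Su, ∑ y ∈ G.neighborFinset x, (f x - f y) = f u - f v := by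
  have hnbr : ∀ x, ∑ y ∈ G.neighborFinset x, (f x - f y) =
      ∑ y with y ∈ Su, (if G.Adj x y then f x - f y else 0) +
        ∑ y with y ∉ Su, (if G.Adj x y then f x - f y else 0) := by
    intro x
    rw [Finset.sum_filter_add_sum_filter_not, ← Finset.sum_filter]
    exact Finset.sum_congr (by ext; simp) fun _ _ => rfl
  simp only [hnbr, Finset.sum_add_distrib]
  have hin : ∑ x with x ∈ Su, ∑ y with y ∈ Su, (if G.Adj x y then f x - f y else 0) = 0 := by
    have hanti : ∑ x with x ∈ Su, ∑ y with y ∈ Su, (if G.Adj x y then f x - f y else 0) =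
        - ∑ x with x ∈ Su, ∑ y with y ∈ Su, (if G.Adj x y then f x - f y else 0) := by
      -- Exchanging the two ends of an inner edge reverses the sign, so the sum equals its own
      -- negative.
      conv_lhs => rw [Finset.sum_comm]
      rw [← Finset.sum_neg_distrib]
      refine Finset.sum_congr rfl fun x _ => ?_
      rw [← Finset.sum_neg_distrib]
      refine Finset.sum_congr rfl fun y _ => ?_
      rw [G.adj_comm y x]
      split_ifs <;> ring
    linarith
  rw [hin, zero_add, Finset.sum_eq_single_of_mem u (by simp [h.left_mem]),
    Finset.sum_eq_single_of_mem v (by simp [h.notMem_left]), if_pos h.adj]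
  · intro y hy hyv
    exact if_neg fun hadj => hyv (h.eq_of_adj h.left_mem (Finset.mem_filter.1 hy).2 hadj).2
  · intro x hx hxu
    refine Finset.sum_eq_zero fun y hy => if_neg fun hadj => hxu ?_
    exact (h.eq_of_adj (Finset.mem_filter.1 hx).2 (Finset.mem_filter.1 hy).2 hadj).1

open scoped Classical in
theorem IsBridgeSplit.hittingTime_across (h : IsBridgeSplit G u v Su Sv) :
    (hittingTime G u v).toReal = ∑ x with x ∈ Su, (G.degree x : ℝ) := by
  have hflux := h.sum_sum_sub fun x => (hittingTime G x v).toReal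
  rw [hittingTime_self, ENNReal.toReal_zero, sub_zero] at hflux
  rw [← hflux]
  refine Finset.sum_congr rfl fun x hx => ?_
  have hxv : x ≠ v := fun e => h.notMem_left (e ▸ (Finset.mem_filter.1 hx).2)
  rw [Finset.sum_sub_distrib, Finset.sum_const, SimpleGraph.card_neighborFinset_eq_degree,
    nsmul_eq_mul, degree_mul_hittingTime h.preconnected hxv]
  ring

/-- From `Su`, the walk has to pass through `u` on its way to `v`. -/
theorem IsBridgeSplit.hittingTime_add (h : IsBridgeSplit G u v Su Sv) {x : V} (hx : x ∈ Su) :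
    (hittingTime G x v).toReal = (hittingTime G x u).toReal + (hittingTime G u v).toReal := by
  classical
  -- The defect of the identity, extended by zero outside `Su`, is harmonic off `u`: it vanishes at
  -- `u`, and the only edge leaving `Su` starts there.
  have key := eq_zero_of_harmonic h.preconnected (v := u)
    (f := fun x => if x ∈ Su then (hittingTime G x v).toReal - (hittingTime G x u).toReal -
      (hittingTime G u v).toReal else 0) (by simp [hittingTime_self]) ?_ x
  · rw [if_pos hx] at key
    linarith
  · intro y hyu
    by_cases hy : y ∈ Su
    · have hyv : y ≠ v := fun e => h.notMem_left (e ▸ hy)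
      rw [if_pos hy, Finset.sum_congr rfl (g := fun z => (hittingTime G z v).toReal -
        (hittingTime G z u).toReal - (hittingTime G u v).toReal)]
      · have h1 := degree_mul_hittingTime h.preconnected hyv
        have h2 := degree_mul_hittingTime h.preconnected hyu
        rw [Finset.sum_sub_distrib, Finset.sum_sub_distrib, Finset.sum_const,
          SimpleGraph.card_neighborFinset_eq_degree, nsmul_eq_mul, mul_sub, mul_sub, h1, h2]
        ring
      · intro z hz
        refine if_pos (by_contra fun hzS => hyu ?_)
        exact (h.eq_of_adj hy hzS ((G.mem_neighborFinset _ _).1 hz)).1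
    · rw [if_neg hy, mul_zero]
      refine Finset.sum_eq_zero fun z hz => ?_
      by_cases hz' : z ∈ Su
      · have := (h.eq_of_adj hz' hy ((G.mem_neighborFinset _ _).1 hz).symm).1
        subst this
        simp [hittingTime_self]
      · exact if_neg hz'

open scoped Classical in
-- Handshake lemma inside `Su`; the extra 1 is the bridge, counted at `u` alone.
theorem IsBridgeSplit.sum_degree (h : IsBridgeSplit G u v Su Sv) :
    ∑ x with x ∈ Su, G.degree x = 2 * (G.induce Su).edgeSet.ncard + 1 := by
  have hsub : ∀ x : Su, G.degree x = (G.induce Su).degree x + if (x : V) = u then 1 else 0 := by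
    intro x
    have hcard : (G.induce Su).degree x = (G.neighborFinset x ∩ Su.toFinset).card := by
      rw [← SimpleGraph.map_neighborFinset_induce, Finset.card_map,
        SimpleGraph.card_neighborFinset_eq_degree]
    rw [hcard, ← SimpleGraph.card_neighborFinset_eq_degree,
      ← Finset.card_inter_add_card_sdiff (G.neighborFinset x) Su.toFinset]
    congr 1
    split_ifs with hxu
    · rw [Finset.card_eq_one]
      refine ⟨v, Finset.eq_singleton_iff_unique_mem.2 ⟨?_, fun y hy => ?_⟩⟩
      · simp [hxu, h.adj, h.notMem_left]
      · simp only [Finset.mem_sdiff, SimpleGraph.mem_neighborFinset, Set.mem_toFinset] at hy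
        exact (h.eq_of_adj x.2 hy.2 hy.1).2
    · refine Finset.card_eq_zero.2 (Finset.eq_empty_of_forall_notMem fun y hy => hxu ?_)
      simp only [Finset.mem_sdiff, SimpleGraph.mem_neighborFinset, Set.mem_toFinset] at hy
      exact (h.eq_of_adj x.2 hy.2 hy.1).1
  have hE : (G.induce Su).edgeSet.ncard = (G.induce Su).edgeFinset.card := by
    rw [Set.ncard_eq_toFinset_card', SimpleGraph.edgeFinset]
  rw [hE, ← SimpleGraph.sum_degrees_eq_twice_card_edges,
    ← Finset.sum_subtype_eq_sum_filter, Finset.subtype_univ]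
  refine (Finset.sum_congr rfl fun x _ => hsub x).trans ?_
  rw [Finset.sum_add_distrib, Finset.sum_eq_single_of_mem
    (f := fun x : Su => if (x : V) = u then 1 else 0) ⟨u, h.left_mem⟩ (Finset.mem_univ _),
    if_pos rfl]
  intro x _ hx
  exact if_neg fun e => hx (Subtype.ext e)

theorem IsBridgeSplit.inv_rwc_sub (h : IsBridgeSplit G u v Su Sv) :
    (rwc G v)⁻¹ - (rwc G u)⁻¹ =
      Su.ncard * (hittingTime G u v).toReal - Sv.ncard * (hittingTime G v u).toReal := by
  classical
  rw [inv_rwc h.preconnected, inv_rwc h.preconnected, ← Finset.sum_sub_distrib,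
    ← Finset.sum_filter_add_sum_filter_not Finset.univ (· ∈ Su),
    Finset.sum_congr rfl (g := fun _ => (hittingTime G u v).toReal),
    Finset.sum_congr (s₁ := Finset.filter (fun x => x ∉ Su) _) rfl
      (g := fun _ => -(hittingTime G v u).toReal), Finset.sum_const, Finset.sum_const,
    nsmul_eq_mul, nsmul_eq_mul, mul_neg, ← sub_eq_add_neg]
  · rw [h.right_eq_compl, Set.ncard_eq_toFinset_card', Set.ncard_eq_toFinset_card',
      ← Set.filter_mem_univ_eq_toFinset, ← Set.filter_mem_univ_eq_toFinset]
    rfl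
  · intro x hx
    have := h.symm.hittingTime_add (x := x) (by
      rw [h.right_eq_compl]; exact (Finset.mem_filter.1 hx).2)
    linarith
  · intro x hx
    have := h.hittingTime_add (Finset.mem_filter.1 hx).2
    linarith

/-- The difference of the total hitting times of the two ends of a bridge. -/
theorem IsBridgeSplit.inv_rwc_sub_eq (h : IsBridgeSplit G u v Su Sv) :
    (rwc G v)⁻¹ - (rwc G u)⁻¹ =
      (Su.ncard : ℝ) * (2 * ((G.induce Su).edgeSet.ncard : ℝ) + 1)
        - (Sv.ncard : ℝ) * (2 * ((G.induce Sv).edgeSet.ncard : ℝ) + 1) := by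
  classical
  rw [h.inv_rwc_sub, h.hittingTime_across, h.symm.hittingTime_across]
  have h1 := h.sum_degree
  have h2 := h.symm.sum_degree
  rify at h1 h2
  rw [h1, h2]

open scoped Classical in
theorem IsBridgeSplit.rwc_lt_rwc (h : IsBridgeSplit G u v Su Sv)
    (hlt : Sv.ncard * ∑ x with x ∈ Sv, G.degree x < Su.ncard * ∑ x with x ∈ Su, G.degree x) :
    rwc G v < rwc G u := by
  have hsub := h.inv_rwc_sub
  rw [h.hittingTime_across, h.symm.hittingTime_across] at hsub
  rify at hlt
  -- Inverting the inequality needs positive values, as real inversion sends 0 to 0. The term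
  -- $H(v,u)=2|E[S_v]|+1$ suffices.
  have hpos : 0 < (rwc G u)⁻¹ := by
    rw [inv_rwc h.preconnected]
    refine Finset.sum_pos' (fun x _ => ENNReal.toReal_nonneg) ⟨v, Finset.mem_univ v, ?_⟩
    rw [h.symm.hittingTime_across, ← Nat.cast_sum, h.symm.sum_degree]
    positivity
  have hinv : (rwc G u)⁻¹ < (rwc G v)⁻¹ := by linarith
  exact (inv_lt_inv₀ (inv_pos.1 hpos) (inv_pos.1 (hpos.trans hinv))).1 hinv

end BridgeFormula

/-! ### Distance comparison across a bridge -/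

section Net

variable {V : Type*} {G : SimpleGraph V} {u v : V} {Su Sv : Set V}

/-- A walk leaving `Su` crosses the bridge; cut it just before the first crossing. -/
theorem IsBridgeSplit.exists_shorter_walk (h : IsBridgeSplit G u v Su Sv) {x y : V} (hx : x ∈ Su)
    (hy : y ∉ Su) (p : G.Walk x y) : ∃ q : G.Walk x u, q.length < p.length := by
  induction p with
  | nil => exact absurd hx hy
  | @cons a b c hab p ih =>
    by_cases hb : b ∈ Su
    · obtain ⟨q, hq⟩ := ih hb hy
      exact ⟨.cons hab q, by simpa using hq⟩
    · obtain ⟨rfl, -⟩ := h.eq_of_adj hx hb hab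
      exact ⟨.nil, by simp⟩

theorem IsBridgeSplit.edist_lt (h : IsBridgeSplit G u v Su Sv) {x : V}
    (hx : x ∈ Su) : G.edist x u < G.edist x v := by
  obtain ⟨p, hp⟩ := (h.preconnected x v).exists_walk_length_eq_edist
  obtain ⟨q, hq⟩ := h.exists_shorter_walk hx h.notMem_left p
  rw [← hp]
  exact (SimpleGraph.edist_le q).trans_lt (by exact_mod_cast hq)

theorem IsBridgeSplit.net_eq (h : IsBridgeSplit G u v Su Sv) : net G u v = Su.ncard := by
  unfold net
  congr 1
  ext x
  refine ⟨fun hlt => by_contra fun hx => ?_, h.edist_lt⟩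
  rw [← Set.mem_compl_iff, ← h.right_eq_compl] at hx
  exact lt_asymm hlt (h.symm.edist_lt hx)

end Net

/-! ### A criterion for bridge splits -/

section Construction

variable {V : Type*} {G : SimpleGraph V} {u v : V} {Su : Set V}

theorem supp_eq_of_reachable {H : SimpleGraph V} {S : Set V} (hS : ∀ x ∈ S, H.Reachable x u)
    (hclosed : ∀ x y, H.Adj x y → x ∈ S → y ∈ S) {x : V} (hx : x ∈ S) :
    (H.connectedComponentMk x).supp = S := by
  have hwalk : ∀ {a b : V} (_ : H.Walk a b), a ∈ S → b ∈ S := by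
    intro a b p
    induction p with
    | nil => exact id
    | cons hab _ ih => exact fun ha => ih (hclosed _ _ hab ha)
  ext y
  rw [SimpleGraph.ConnectedComponent.mem_supp_iff, SimpleGraph.ConnectedComponent.eq]
  exact ⟨fun ⟨p⟩ => hwalk p.reverse hx, fun hy => (hS y hy).trans (hS x hx).symm⟩

theorem IsBridgeSplit.of_reachable (hadj : G.Adj u v) (hu : u ∈ Su) (hv : v ∉ Su)
    (hSu : ∀ x ∈ Su, (G.deleteEdges {s(u, v)}).Reachable x u)
    (hSv : ∀ x ∉ Su, (G.deleteEdges {s(u, v)}).Reachable x v)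
    (hcut : ∀ x y, (G.deleteEdges {s(u, v)}).Adj x y → (x ∈ Su ↔ y ∈ Su)) :
    IsBridgeSplit G u v Su Suᶜ := by
  have hl : ∀ x ∈ Su, ((G.deleteEdges {s(u, v)}).connectedComponentMk x).supp = Su :=
    fun x hx => supp_eq_of_reachable hSu (fun x y h => (hcut x y h).1) hx
  have hr : ∀ x ∈ Suᶜ, ((G.deleteEdges {s(u, v)}).connectedComponentMk x).supp = Suᶜ :=
    fun x hx => supp_eq_of_reachable hSv (fun x y h => mt (hcut x y h).2) hx
  refine ⟨hadj, hu, hv, fun e => ?_, ?_⟩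
  · rw [e] at hu
    exact hu (e ▸ hu)
  · ext S
    constructor
    · rintro ⟨c, rfl⟩
      induction c using SimpleGraph.ConnectedComponent.ind with
      | h x =>
        by_cases hx : x ∈ Su
        · exact Or.inl (hl x hx)
        · exact Or.inr (hr x hx)
    · rintro (rfl | rfl)
      · exact ⟨_, hl u hu⟩
      · exact ⟨_, hr v hv⟩

end Construction

/-! ### The counterexample -/

section CliqueStar

/-- The complete graph on `{0, 1, 2, 3}` joined by the edge `{3, 4}` to the star on
`{4, 5, 6, 7, 8}` with centre `4`. -/
def cliqueStar : SimpleGraph (Fin 9) where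
  Adj i j := i ≠ j ∧ ((i < 4 ∧ j < 4) ∨ (i = 4 ∧ 3 ≤ j) ∨ (j = 4 ∧ 3 ≤ i))
  symm.symm i j h := by tauto
  loopless.irrefl i h := h.1 rfl

instance : DecidableRel cliqueStar.Adj := fun i j =>
  inferInstanceAs (Decidable (i ≠ j ∧ ((i < 4 ∧ j < 4) ∨ (i = 4 ∧ 3 ≤ j) ∨ (j = 4 ∧ 3 ≤ i))))

theorem cliqueStar_deleteEdges_adj {i j : Fin 9} :
    (cliqueStar.deleteEdges {s(3, 4)}).Adj i j ↔ cliqueStar.Adj i j ∧ (i < 4 ↔ j < 4) := by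
  rw [SimpleGraph.deleteEdges_adj, Set.mem_singleton_iff]
  revert i j
  decide

theorem cliqueStar_isBridgeSplit :
    IsBridgeSplit cliqueStar 3 4 {i | i < 4} {i | i < 4}ᶜ := by
  refine .of_reachable (by decide) (by decide) (by decide) (fun x hx => ?_) (fun x hx => ?_)
    fun x y h => (cliqueStar_deleteEdges_adj.1 h).2
  · by_cases h : x = 3
    · rw [h]
    -- On either side, every other node is adjacent to the end of the bridge.
    · refine (cliqueStar_deleteEdges_adj.2 ?_).reachable
      change x < 4 at hx
      revert x; decide
  · by_cases h : x = 4
    · rw [h]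
    · refine (cliqueStar_deleteEdges_adj.2 ?_).reachable
      change ¬ x < 4 at hx
      revert x; decide

theorem ncard_cliqueStar_left : {i : Fin 9 | i < 4}.ncard = 4 := by
  rw [Set.ncard_eq_toFinset_card']; decide

theorem ncard_cliqueStar_right : ({i : Fin 9 | i < 4}ᶜ).ncard = 5 := by
  rw [Set.ncard_eq_toFinset_card']; decide

theorem cliqueStar_rwc_lt : rwc cliqueStar 4 < rwc cliqueStar 3 := by
  -- The values are $5\cdot 9=45$ for the star and $4\cdot 13=52$ for the clique.
  have hlt : 5 * ∑ x with x ∈ ({i : Fin 9 | i < 4}ᶜ : Set (Fin 9)), cliqueStar.degree x <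
      4 * ∑ x with x ∈ {i : Fin 9 | i < 4}, cliqueStar.degree x := by decide
  refine cliqueStar_isBridgeSplit.rwc_lt_rwc ?_
  rw [ncard_cliqueStar_left, ncard_cliqueStar_right]
  convert! hlt

theorem cliqueStar_beats : Beats cliqueStar 4 3 := by
  rw [Beats, cliqueStar_isBridgeSplit.net_eq, cliqueStar_isBridgeSplit.symm.net_eq,
    ncard_cliqueStar_left, ncard_cliqueStar_right]
  norm_num

end CliqueStar

end GraphCentrality

end

theorem mainTheorem9 :
    (∀ {V : Type*} [Fintype V] (G : SimpleGraph V) (u v : V) (Su Sv : Set V),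
      GraphCentrality.IsBridgeSplit G u v Su Sv →
        (∀ x y : V, GraphCentrality.hittingTime G x y ≠ ⊤) ∧
        (GraphCentrality.rwc G v)⁻¹ - (GraphCentrality.rwc G u)⁻¹ =
          (Su.ncard : ℝ) * (2 * ((G.induce Su).edgeSet.ncard : ℝ) + 1)
            - (Sv.ncard : ℝ) * (2 * ((G.induce Sv).edgeSet.ncard : ℝ) + 1)) ∧
    ¬ GraphCentrality.CondorcetComparison GraphCentrality.rwCloseness ∧
    ¬ GraphCentrality.BridgeAxiom GraphCentrality.rwCloseness ∧
    (∃ (n : ℕ) (G : SimpleGraph (Fin n)) (u v : Fin n) (Su Sv : Set (Fin n)),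
      GraphCentrality.IsBridgeSplit G u v Su Sv ∧
        Su.ncard < Sv.ncard ∧ GraphCentrality.Beats G v u ∧
        GraphCentrality.rwCloseness (Fin n) G v < GraphCentrality.rwCloseness (Fin n) G u) := by
  have hsplit := GraphCentrality.cliqueStar_isBridgeSplit
  have hlt := GraphCentrality.cliqueStar_rwc_lt
  have hbeats := GraphCentrality.cliqueStar_beats
  have hcard : ({i : Fin 9 | i < 4}).ncard < ({i : Fin 9 | i < 4}ᶜ).ncard := by
    rw [GraphCentrality.ncard_cliqueStar_left, GraphCentrality.ncard_cliqueStar_right]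
    norm_num
  refine ⟨fun G u v Su Sv h =>
      ⟨GraphCentrality.hittingTime_ne_top h.preconnected, h.inv_rwc_sub_eq⟩, fun hC => ?_,
    fun hB => not_le_of_gt hcard ((hB _ _ _ _ _ _ hsplit).2 hlt.le),
    9, _, 3, 4, _, _, hsplit, hcard, hbeats, hlt⟩
  rcases (hC _ _ ⟨hsplit.preconnected⟩ _ _ hsplit.adj).2 hlt.le with h | h
  · exact lt_asymm h hbeats
  · exact hbeats.ne h
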